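/- Let $\Gamma$ be a simple graph with vertex set $\{1,\dots,N\}$, and let $A=\langle a_1,\dots,a_N \mid a_ia_j=a_ja_i \text{ whenever } i,j \text{ are not joined by an edge of } \Gamma\rangle$ be the corresponding right-angled Artin group. Words are finite sequences of letters $a_i^{\pm1}$, $1\le i\le N$; the index of the letter $a_i^{\pm1}$ is $i$. Say that the letters $a_i^{\pm1}$ and $a_j^{\pm1}$ commute if $i,j$ are not joined by an edge of $\Gamma$ (in particular if $i=j$). A word is *reduced* if it has no subword $a_i^{\varepsilon}xa_i^{-\varepsilon}$ with $\varepsilon=\pm1$ and all letters of $x$ commuting with $a_i$. A reduced word $w$ is *initially normal* if it is empty, or if the index of its first letter is greater than or equal to the index of the first letter of every reduced word representing the same element of $A$ as $w$; a reduced word is *normal* if all its suffixes are initially normal. A word is *cyclically reduced* if it is reduced and every word obtained from it by a finite sequence of cyclings (moving the first letter to the end) and commutations (exchanging two adjacent commuting letters) is reduced. A cyclically reduced word is a *cyclic normal form* if it and all its cyclic permutations are normal. Let $w$ and $w'$ be two cyclic normal forms. Then $w$ and $w'$ represent conjugate elements of $A$ if and only if $w'$ is a cyclic permutation of $w$ (as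 a word). -/

import Mathlib

namespace RAAG

/-- A letter `a_i` (as `(i, true)`) or `a_i⁻¹` (as `(i, false)`). -/
abbrev Letter (N : ℕ) : Type := Fin N × Bool

/-- Words in the letters `a_i^{±1}`; they are not identified up to free reduction. -/
abbrev Word (N : ℕ) : Type := List (Letter N)

variable {N : ℕ}

/-- The defining relators: `a_i` and `a_j` commute whenever `i` and `j` are *not* joined by an
edge of the defining graph. -/
def relators (Γ : SimpleGraph (Fin N)) : Set (FreeGroup (Fin N)) :=
  {r | ∃ i j : Fin N, ¬ Γ.Adj i j ∧
    r = FreeGroup.of i * FreeGroup.of j * (FreeGroup.of i)⁻¹ * (FreeGroup.of j)⁻¹}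

/-- The right-angled Artin group with defining graph `Γ` (edges join non-commuting generators). -/
abbrev ArtinGroup (Γ : SimpleGraph (Fin N)) : Type := PresentedGroup (relators Γ)

/-- The element of the group represented by a word. -/
def eval (Γ : SimpleGraph (Fin N)) (w : Word N) : ArtinGroup Γ :=
  PresentedGroup.mk (relators Γ) (FreeGroup.mk w)

/-- A word is reduced if it has no subword `a_i^{±1} x a_i^{∓1}` with all letters of `x`
commuting with `a_i`. -/
def IsReduced (Γ : SimpleGraph (Fin N)) (w : Word N) : Prop :=
  ¬ ∃ (u x v : Word N) (i : Fin N) (ε : Bool),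
    w = u ++ (i, ε) :: x ++ (i, !ε) :: v ∧ ∀ l ∈ x, ¬ Γ.Adj i l.1

/-- A reduced word is initially normal if it is empty or the index of its first letter is at least
the index of the first letter of every reduced word representing the same element. -/
def IsInitiallyNormal (Γ : SimpleGraph (Fin N)) (w : Word N) : Prop :=
  IsReduced Γ w ∧ ∀ (l : Letter N) (t : Word N), w = l :: t →
    ∀ (l' : Letter N) (t' : Word N), IsReduced Γ (l' :: t') →
      eval Γ (l' :: t') = eval Γ w → l'.1 ≤ l.1

/-- A reduced word is normal if all its suffixes are initially normal. -/
def IsNormal (Γ : SimpleGraph (Fin N)) (w : Word N) : Prop :=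
  IsReduced Γ w ∧ ∀ s : Word N, s <:+ w → IsInitiallyNormal Γ s

/-- One cycling (the first letter is moved to the end) or one commutation (two adjacent letters
that commute are exchanged). -/
inductive Step (Γ : SimpleGraph (Fin N)) : Word N → Word N → Prop
  | cycling (l : Letter N) (t : Word N) : Step Γ (l :: t) (t ++ [l])
  | commutation (u v : Word N) (l l' : Letter N) (h : ¬ Γ.Adj l.1 l'.1) :
      Step Γ (u ++ l :: l' :: v) (u ++ l' :: l :: v)

/-- A word is cyclically reduced if it is reduced and every word obtained from it by a sequence of
cyclings and commutations is still reduced. -/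
def IsCyclicallyReduced (Γ : SimpleGraph (Fin N)) (w : Word N) : Prop :=
  IsReduced Γ w ∧ ∀ w' : Word N, Relation.ReflTransGen (Step Γ) w w' → IsReduced Γ w'

/-- A cyclically reduced word is a cyclic normal form if it and all its cyclic permutations
are normal. -/
def IsCyclicNormalForm (Γ : SimpleGraph (Fin N)) (w : Word N) : Prop :=
  IsCyclicallyReduced Γ w ∧ IsNormal Γ w ∧ ∀ w' : Word N, w ~r w' → IsNormal Γ w'

end RAAG

/-! A rotation is a sequence of cyclings, and cyclings conjugate. The converse has two halves.
Conjugacy gives a path of cyclings and commutations (`IsCyclicallyReduced.steps_of_isConj`). The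
group acts on reduced words up to commutation, so reduced words with the same value differ by
commutations (`commEquiv_of_eval_eq`). Given `w g = g w'`, letters of `g` are then absorbed one at a
time, at the cost of cycling `w` or `w'`.

For the second half, repeat a word periodically over ℤ. A cycling becomes a translation and a
commutation becomes a permutation of ℤ, both preserving the order of any two positions with equal or
adjacent indices. For cyclic normal forms the periodic words are normal everywhere, which forces
such a permutation to be increasing (`strictMono_of_isBiNormal`), hence a translation. Periodic
words that are translates, with periods of equal length, come from rotated words. -/

namespace RAAG

variable {N : ℕ} {Γ : SimpleGraph (Fin N)}

/-! ### Commutation of letters and reduced words -/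

/-- The formal inverse of a letter. -/
def inv (l : Letter N) : Letter N := (l.1, !l.2)

@[simp] theorem inv_fst (l : Letter N) : (inv l).1 = l.1 := rfl

@[simp] theorem inv_inv (l : Letter N) : inv (inv l) = l := by simp [inv]

theorem eq_or_eq_inv_of_fst_eq {l m : Letter N} (h : l.1 = m.1) : l = m ∨ l = inv m := by
  obtain ⟨i, a⟩ := l
  obtain ⟨j, b⟩ := m
  cases a <;> cases b <;> simp_all [inv]

/-- Equality of words up to exchanging adjacent commuting letters. -/
inductive CommEquiv (Γ : SimpleGraph (Fin N)) : Word N → Word N → Prop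
  | nil : CommEquiv Γ [] []
  | cons (l : Letter N) {u v : Word N} (h : CommEquiv Γ u v) : CommEquiv Γ (l :: u) (l :: v)
  | swap (l l' : Letter N) (u : Word N) (h : ¬ Γ.Adj l.1 l'.1) :
      CommEquiv Γ (l :: l' :: u) (l' :: l :: u)
  | trans {u v w : Word N} (h : CommEquiv Γ u v) (h' : CommEquiv Γ v w) : CommEquiv Γ u w

namespace CommEquiv

theorem refl (u : Word N) : CommEquiv Γ u u := by
  induction u with
  | nil => exact .nil
  | cons l u ih => exact ih.cons l

theorem symm {u v : Word N} (h : CommEquiv Γ u v) : CommEquiv Γ v u := by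
  induction h with
  | nil => exact .nil
  | cons l _ ih => exact ih.cons l
  | swap l l' u h => exact .swap l' l u (fun h' => h h'.symm)
  | trans _ _ ih ih' => exact ih'.trans ih

theorem length_eq {u v : Word N} (h : CommEquiv Γ u v) : u.length = v.length := by
  induction h with
  | nil => rfl
  | cons l _ ih => simp [ih]
  | swap => simp
  | trans _ _ ih ih' => exact ih.trans ih'

theorem append_left (t : Word N) {u v : Word N} (h : CommEquiv Γ u v) :
    CommEquiv Γ (t ++ u) (t ++ v) := by
  induction t with
  | nil => exact h
  | cons l t ih => exact ih.cons l

theorem erase {u v : Word N} (h : CommEquiv Γ u v) (m : Letter N) :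
    CommEquiv Γ (u.erase m) (v.erase m) := by
  induction h with
  | nil => exact .nil
  | @cons l u v h ih =>
    by_cases hl : l = m
    · simpa [hl] using h
    · simpa [List.erase_cons, hl] using ih.cons l
  | swap l l' u h =>
    by_cases hl : l = m <;> by_cases hl' : l' = m
    · subst hl; subst hl'; exact refl _
    · simpa [List.erase_cons, hl, hl'] using refl _
    · simpa [List.erase_cons, hl, hl'] using refl _
    · simpa [List.erase_cons, hl, hl'] using .swap l l' _ h
  | trans _ _ ih ih' => exact ih.trans ih'

/-- A letter commuting with all letters of a word can be moved across that word. -/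
theorem move (l : Letter N) (u t : Word N) (h : ∀ b ∈ u, ¬ Γ.Adj l.1 b.1) :
    CommEquiv Γ (l :: (u ++ t)) (u ++ l :: t) := by
  induction u with
  | nil => exact refl _
  | cons b u ih =>
    exact (swap l b _ (h b (by simp))).trans ((ih fun c hc => h c (by simp [hc])).cons b)

end CommEquiv

/-- The letter `l` can be brought to the front of the word by commutations. -/
def IsInitial (Γ : SimpleGraph (Fin N)) (l : Letter N) : Word N → Prop
  | [] => False
  | b :: t => b = l ∨ (¬ Γ.Adj l.1 b.1 ∧ IsInitial Γ l t)

theorem IsInitial.congr {u v : Word N} (h : CommEquiv Γ u v) (m : Letter N) :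
    IsInitial Γ m u ↔ IsInitial Γ m v := by
  induction h with
  | nil => rfl
  | cons l _ ih => simp [IsInitial, ih]
  | swap l l' u h =>
    have h' : ¬ Γ.Adj l'.1 l.1 := fun h' => h h'.symm
    simp only [IsInitial]
    grind
  | trans _ _ ih ih' => exact ih.trans ih'

theorem IsInitial.commEquiv {l : Letter N} {u : Word N} (h : IsInitial Γ l u) :
    CommEquiv Γ u (l :: u.erase l) := by
  induction u with
  | nil => exact h.elim
  | cons b t ih =>
    by_cases hb : b = l
    · subst hb; simpa using CommEquiv.refl _
    · obtain ⟨h1, h2⟩ := h.resolve_left hb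
      have : (b :: t).erase l = b :: t.erase l := by simp [hb]
      rw [this]
      exact ((ih h2).cons b).trans (.swap b l _ fun h' => h1 h'.symm)

theorem isInitial_iff_exists {l : Letter N} {u : Word N} :
    IsInitial Γ l u ↔ ∃ x v, u = x ++ l :: v ∧ ∀ b ∈ x, ¬ Γ.Adj l.1 b.1 := by
  induction u with
  | nil => simp [IsInitial]
  | cons b t ih =>
    simp only [IsInitial, ih]
    constructor
    · rintro (rfl | ⟨h, x, v, rfl, hx⟩)
      · exact ⟨[], t, rfl, by simp⟩
      · exact ⟨b :: x, v, rfl, List.forall_mem_cons.2 ⟨h, hx⟩⟩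
    · rintro ⟨x, v, h, hx⟩
      cases x with
      | nil => simp at h; exact .inl h.1
      | cons c x =>
        simp only [List.cons_append, List.cons.injEq] at h
        obtain ⟨rfl, rfl⟩ := h
        exact .inr ⟨hx b (by simp), x, v, rfl, fun c hc => hx c (by simp [hc])⟩

theorem isInitial_append {l : Letter N} {u v : Word N} (h : IsInitial Γ l (u ++ v)) :
    IsInitial Γ l u ∨ ((∀ b ∈ u, ¬ Γ.Adj l.1 b.1) ∧ IsInitial Γ l v) := by
  induction u with
  | nil => exact .inr ⟨by simp, h⟩
  | cons b t ih =>
    rcases h with h | ⟨h, h'⟩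
    · exact .inl (.inl h)
    · rcases ih h' with ih | ⟨ih, ih'⟩
      · exact .inl (.inr ⟨h, ih⟩)
      · exact .inr ⟨List.forall_mem_cons.2 ⟨h, ih⟩, ih'⟩

theorem isReduced_nil : IsReduced Γ ([] : Word N) := by
  rintro ⟨u, x, v, i, ε, h, -⟩
  simp at h

/-- A cancelling pair either lies inside `u` or starts at `l`. This recursive form makes induction
on words possible. -/
theorem isReduced_cons {l : Letter N} {u : Word N} :
    IsReduced Γ (l :: u) ↔ IsReduced Γ u ∧ ¬ IsInitial Γ (inv l) u := by
  rw [isInitial_iff_exists]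
  constructor
  · refine fun h => ⟨?_, ?_⟩
    · rintro ⟨p, x, v, i, ε, rfl, hx⟩
      exact h ⟨l :: p, x, v, i, ε, rfl, hx⟩
    · rintro ⟨x, v, rfl, hx⟩
      exact h ⟨[], x, v, l.1, l.2, rfl, hx⟩
  · rintro ⟨h, h'⟩ ⟨p, x, v, i, ε, e, hx⟩
    cases p with
    | nil =>
      simp only [List.nil_append, List.cons_append, List.cons.injEq] at e
      obtain ⟨rfl, rfl⟩ := e
      exact h' ⟨x, v, rfl, hx⟩
    | cons c p =>
      simp only [List.cons_append, List.cons.injEq] at e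
      obtain ⟨rfl, rfl⟩ := e
      exact h ⟨p, x, v, i, ε, by simp, hx⟩

theorem IsReduced.congr {u v : Word N} (h : CommEquiv Γ u v) :
    IsReduced Γ u ↔ IsReduced Γ v := by
  induction h with
  | nil => rfl
  | cons l h ih => rw [isReduced_cons, isReduced_cons, ih, IsInitial.congr h]
  | swap l l' u h =>
    have h' : ¬ Γ.Adj l'.1 l.1 := fun h' => h h'.symm
    have e : l = inv l' ↔ l' = inv l := by
      constructor <;> (rintro rfl; simp)
    simp only [isReduced_cons, IsInitial, inv_fst]
    grind
  | trans _ _ ih ih' => exact ih.trans ih'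

/-- Two reduced words whose product is not reduced have a cancelling pair at the junction. -/
theorem exists_cancel_of_not_isReduced_append {u v : Word N} (hu : IsReduced Γ u)
    (hv : IsReduced Γ v) (h : ¬ IsReduced Γ (u ++ v)) :
    ∃ l u' v', CommEquiv Γ u (u' ++ [l]) ∧ CommEquiv Γ v (inv l :: v') := by
  induction u with
  | nil => exact absurd hv h
  | cons b u ih =>
    rw [isReduced_cons] at hu
    by_cases h0 : IsReduced Γ (u ++ v)
    · rw [List.cons_append, isReduced_cons] at h
      have h1 : IsInitial Γ (inv b) (u ++ v) := by_contra fun h1 => h ⟨h0, h1⟩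
      -- The partner of `b` is not in `u`, since `b :: u` is reduced. So it lies in `v`, and `b`
      -- commutes past all of `u` to the junction.
      obtain ⟨h2, h3⟩ := (isInitial_append h1).resolve_left hu.2
      exact ⟨b, u, _, by simpa using CommEquiv.move b u [] h2, h3.commEquiv⟩
    · obtain ⟨l, u', v', h1, h2⟩ := ih hu.1 h0
      exact ⟨l, b :: u', v', h1.cons b, h2⟩

/-! ### The group element of a word -/

theorem eval_nil : eval Γ [] = 1 := rfl

theorem eval_append (u v : Word N) : eval Γ (u ++ v) = eval Γ u * eval Γ v := by
  rw [eval, ← FreeGroup.mul_mk, map_mul]; rfl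

theorem eval_cons (l : Letter N) (u : Word N) : eval Γ (l :: u) = eval Γ [l] * eval Γ u :=
  eval_append [l] u

theorem eval_inv (l : Letter N) : eval Γ [inv l] = (eval Γ [l])⁻¹ := by
  rw [eval, eval, ← map_inv, FreeGroup.inv_mk]; rfl

theorem eval_commute_of {i j : Fin N} (h : ¬ Γ.Adj i j) :
    Commute (eval Γ [(i, true)]) (eval Γ [(j, true)]) := by
  have : PresentedGroup.mk (relators Γ)
      (FreeGroup.of i * FreeGroup.of j * (FreeGroup.of i)⁻¹ * (FreeGroup.of j)⁻¹) = 1 :=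
    PresentedGroup.one_of_mem ⟨i, j, h, rfl⟩
  simp only [map_mul, map_inv] at this
  rw [mul_inv_eq_one, mul_inv_eq_iff_eq_mul] at this
  exact this

theorem eval_commute {l m : Letter N} (h : ¬ Γ.Adj l.1 m.1) :
    Commute (eval Γ [l]) (eval Γ [m]) := by
  have key (i : Fin N) : eval Γ [(i, false)] = (eval Γ [(i, true)])⁻¹ := eval_inv (i, true)
  have := eval_commute_of h
  obtain ⟨i, a⟩ := l
  obtain ⟨j, b⟩ := m
  cases a <;> cases b <;> simpa [key] using this

theorem CommEquiv.eval_eq {u v : Word N} (h : CommEquiv Γ u v) : eval Γ u = eval Γ v := by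
  induction h with
  | nil => rfl
  | cons l h ih => rw [eval_cons, ih, ← eval_cons]
  | swap l l' u h =>
    rw [eval_cons l, eval_cons l' u, eval_cons l' (l :: u), eval_cons l u, ← mul_assoc,
      ← mul_assoc, (eval_commute h).eq]
  | trans _ _ ih ih' => exact ih.trans ih'

/-! ### The action of the group on reduced words up to commutation -/

open Classical in
/-- Left multiplication of a reduced word by a letter. -/
noncomputable def letterMul (Γ : SimpleGraph (Fin N)) (l : Letter N) (u : Word N) : Word N :=
  if IsInitial Γ (inv l) u then u.erase (inv l) else l :: u

theorem IsReduced.letterMul {u : Word N} (h : IsReduced Γ u) (l : Letter N) :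
    IsReduced Γ (letterMul Γ l u) := by
  unfold RAAG.letterMul
  split_ifs with hi
  · exact (isReduced_cons.1 ((IsReduced.congr hi.commEquiv).1 h)).1
  · exact isReduced_cons.2 ⟨h, hi⟩

theorem letterMul_congr {u v : Word N} (h : CommEquiv Γ u v) (l : Letter N) :
    CommEquiv Γ (letterMul Γ l u) (letterMul Γ l v) := by
  unfold letterMul
  rw [IsInitial.congr h]
  split_ifs
  · exact h.erase _
  · exact h.cons l

theorem letterMul_inv_letterMul {u : Word N} (h : IsReduced Γ u) (l : Letter N) :
    CommEquiv Γ (letterMul Γ (inv l) (letterMul Γ l u)) u := by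
  by_cases hi : IsInitial Γ (inv l) u
  · have h1 := isReduced_cons.1 ((IsReduced.congr hi.commEquiv).1 h)
    rw [inv_inv] at h1
    simpa [letterMul, hi, h1.2] using hi.commEquiv.symm
  · simpa [letterMul, hi, IsInitial] using CommEquiv.refl u

/-- Since the indices are distinct and not joined, prepending or erasing one letter does not affect
whether the other one cancels. The four cases then agree on the nose or by a single swap. -/
theorem letterMul_comm {l m : Letter N} (h : ¬ Γ.Adj l.1 m.1) (hne : l.1 ≠ m.1) (u : Word N) :
    CommEquiv Γ (letterMul Γ l (letterMul Γ m u)) (letterMul Γ m (letterMul Γ l u)) := by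
  have h' : ¬ Γ.Adj m.1 l.1 := fun h' => h h'.symm
  have n1 : m ≠ inv l := fun e => hne (congrArg Prod.fst e).symm
  have n2 : l ≠ inv m := fun e => hne (congrArg Prod.fst e :)
  have n3 : inv m ≠ inv l := fun e => hne (congrArg Prod.fst e).symm
  have c1 (v : Word N) : IsInitial Γ (inv l) (m :: v) ↔ IsInitial Γ (inv l) v := by
    simp [IsInitial, n1, h]
  have c2 (v : Word N) : IsInitial Γ (inv m) (l :: v) ↔ IsInitial Γ (inv m) v := by
    simp [IsInitial, n2, h']
  have d1 (hm : IsInitial Γ (inv m) u) :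
      IsInitial Γ (inv l) (u.erase (inv m)) ↔ IsInitial Γ (inv l) u := by
    rw [IsInitial.congr hm.commEquiv (inv l)]
    simp [IsInitial, n3, h]
  have d2 (hl : IsInitial Γ (inv l) u) :
      IsInitial Γ (inv m) (u.erase (inv l)) ↔ IsInitial Γ (inv m) u := by
    rw [IsInitial.congr hl.commEquiv (inv m)]
    simp [IsInitial, n3.symm, h']
  by_cases hl : IsInitial Γ (inv l) u <;> by_cases hm : IsInitial Γ (inv m) u
  · simpa [letterMul, hl, hm, d1 hm, d2 hl, List.erase_comm] using CommEquiv.refl _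
  · simpa [letterMul, hl, hm, c1, d2 hl, List.erase_cons, n1] using CommEquiv.refl _
  · simpa [letterMul, hl, hm, c2, d1 hm, List.erase_cons, n2] using CommEquiv.refl _
  · simpa [letterMul, hl, hm, c1, c2] using CommEquiv.swap l m u h

/-- Commutation equivalence on reduced words. -/
def reducedSetoid (Γ : SimpleGraph (Fin N)) : Setoid {u : Word N // IsReduced Γ u} where
  r u v := CommEquiv Γ u.1 v.1
  iseqv := ⟨fun u => .refl u.1, fun h => h.symm, fun h h' => h.trans h'⟩

/-- Reduced words up to commutation. -/
abbrev ReducedClass (Γ : SimpleGraph (Fin N)) : Type := Quotient (reducedSetoid Γ)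

/-- The action of a letter on classes of reduced words. -/
noncomputable def letterAct (Γ : SimpleGraph (Fin N)) (l : Letter N) : ReducedClass Γ → ReducedClass Γ :=
  Quotient.map (sa := reducedSetoid Γ) (sb := reducedSetoid Γ)
    (fun u => ⟨letterMul Γ l u.1, u.2.letterMul l⟩) fun _ _ h => letterMul_congr h l

theorem letterAct_inv_letterAct (l : Letter N) (x : ReducedClass Γ) :
    letterAct Γ (inv l) (letterAct Γ l x) = x := by
  induction x using Quotient.inductionOn with
  | h u => exact Quotient.sound (s := reducedSetoid Γ) (letterMul_inv_letterMul u.2 l)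

theorem letterAct_comm {l m : Letter N} (h : ¬ Γ.Adj l.1 m.1) (hne : l.1 ≠ m.1)
    (x : ReducedClass Γ) :
    letterAct Γ l (letterAct Γ m x) = letterAct Γ m (letterAct Γ l x) := by
  induction x using Quotient.inductionOn with
  | h u => exact Quotient.sound (s := reducedSetoid Γ) (letterMul_comm h hne u.1)

/-- The permutation of the classes of reduced words given by a generator. -/
noncomputable def generatorPerm (Γ : SimpleGraph (Fin N)) (i : Fin N) : Equiv.Perm (ReducedClass Γ) where
  toFun := letterAct Γ (i, true)
  invFun := letterAct Γ (i, false)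
  left_inv := letterAct_inv_letterAct (i, true)
  right_inv := letterAct_inv_letterAct (i, false)

/-- The action of the group on classes of reduced words. -/
noncomputable def reducedAction (Γ : SimpleGraph (Fin N)) : ArtinGroup Γ →* Equiv.Perm (ReducedClass Γ) :=
  PresentedGroup.toGroup (f := generatorPerm Γ) <| by
    rintro r ⟨i, j, h, rfl⟩
    simp only [map_mul, map_inv, FreeGroup.lift_apply_of]
    rw [mul_inv_eq_one, mul_inv_eq_iff_eq_mul]
    by_cases hij : i = j
    · rw [hij]
    · exact Equiv.ext fun x => letterAct_comm (l := (i, true)) (m := (j, true)) h hij x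

theorem reducedAction_eval_singleton (l : Letter N) (x : ReducedClass Γ) :
    reducedAction Γ (eval Γ [l]) x = letterAct Γ l x := by
  have key (i : Fin N) : reducedAction Γ (eval Γ [(i, true)]) = generatorPerm Γ i :=
    PresentedGroup.toGroup.of _
  obtain ⟨i, b⟩ := l
  cases b
  · have : eval Γ [(i, false)] = (eval Γ [(i, true)])⁻¹ := eval_inv (i, true)
    rw [this, map_inv, key]; rfl
  · rw [key]; rfl

/-- No cancellation ever occurs while a reduced word is built up from the empty one, so its class
can be read off from its group element. -/
theorem reducedAction_eval {u : Word N} (h : IsReduced Γ u) :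
    reducedAction Γ (eval Γ u) (Quotient.mk (reducedSetoid Γ) ⟨[], isReduced_nil⟩) =
      Quotient.mk (reducedSetoid Γ) ⟨u, h⟩ := by
  induction u with
  | nil => rw [eval_nil, map_one]; rfl
  | cons l u ih =>
    have h' := isReduced_cons.1 h
    rw [eval_cons, map_mul, Equiv.Perm.mul_apply, ih h'.1, reducedAction_eval_singleton]
    refine Quotient.sound (s := reducedSetoid Γ) ?_
    change CommEquiv Γ (letterMul Γ l u) (l :: u)
    rw [letterMul, if_neg h'.2]
    exact .refl _

/-- Reduced words representing the same element differ by commutations. -/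
theorem commEquiv_of_eval_eq {u v : Word N} (hu : IsReduced Γ u) (hv : IsReduced Γ v)
    (h : eval Γ u = eval Γ v) : CommEquiv Γ u v :=
  Quotient.exact (s := reducedSetoid Γ)
    ((reducedAction_eval hu).symm.trans (h ▸ reducedAction_eval hv))

theorem exists_shorter_of_not_isReduced {u : Word N} (h : ¬ IsReduced Γ u) :
    ∃ v : Word N, v.length < u.length ∧ eval Γ v = eval Γ u := by
  induction u with
  | nil => exact absurd isReduced_nil h
  | cons l u ih =>
    by_cases hu : IsReduced Γ u
    · have hi : IsInitial Γ (inv l) u := by_contra fun hi => h (isReduced_cons.2 ⟨hu, hi⟩)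
      refine ⟨u.erase (inv l), ?_, ?_⟩
      · have := hi.commEquiv.length_eq
        simp only [List.length_cons] at this ⊢
        omega
      · rw [eval_cons, hi.commEquiv.eval_eq, eval_cons (inv l), eval_inv, mul_inv_cancel_left]
    · obtain ⟨v, hv, e⟩ := ih hu
      exact ⟨l :: v, by simpa using hv, by rw [eval_cons, e, ← eval_cons]⟩

/-! ### Conjugate cyclically reduced words -/

open Relation

theorem CommEquiv.steps_append {u v : Word N} (h : CommEquiv Γ u v) (p : Word N) :
    ReflTransGen (Step Γ) (p ++ u) (p ++ v) := by
  induction h generalizing p with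
  | nil => exact .refl
  | cons l _ ih => simpa using ih (p ++ [l])
  | swap l l' u h => exact .single (.commutation p u l l' h)
  | trans _ _ ih ih' => exact (ih p).trans (ih' p)

theorem CommEquiv.steps {u v : Word N} (h : CommEquiv Γ u v) : ReflTransGen (Step Γ) u v :=
  h.steps_append []

theorem steps_append_comm (u v : Word N) : ReflTransGen (Step Γ) (u ++ v) (v ++ u) := by
  induction u generalizing v with
  | nil => simpa using .refl
  | cons l u ih =>
    refine .head (.cycling l (u ++ v)) ?_
    simpa using ih (v ++ [l])

theorem IsCyclicallyReduced.of_steps {u v : Word N} (hu : IsCyclicallyReduced Γ u)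
    (h : ReflTransGen (Step Γ) u v) : IsCyclicallyReduced Γ v :=
  ⟨hu.2 v h, fun w hw => hu.2 w (h.trans hw)⟩

theorem Step.isConj {u v : Word N} (h : Step Γ u v) : IsConj (eval Γ u) (eval Γ v) := by
  cases h with
  | cycling l t =>
    rw [isConj_iff]
    exact ⟨(eval Γ [l])⁻¹, by rw [eval_cons l t, eval_append]; group⟩
  | commutation p q l l' h =>
    rw [(CommEquiv.append_left p (.swap l l' q h)).eval_eq]

theorem steps_isConj {u v : Word N} (h : ReflTransGen (Step Γ) u v) :
    IsConj (eval Γ u) (eval Γ v) := by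
  induction h with
  | refl => exact IsConj.refl _
  | tail _ h ih => exact ih.trans h.isConj

/-- Induction on the length of `g`. If `g` is not reduced, it can be shortened. If a letter cancels
at the junction of `w g` or of `g w'`, it is cycled around `w` or `w'` and removed from `g`.
Otherwise both products are reduced, hence commutation equivalent, so the first letter of `g` is
initial in `w g`: either it is initial in `w` and can be cycled to the end, or it commutes with all
of `w` and can be dropped. -/
theorem steps_of_eval_mul_eq (g : Word N) {w w' : Word N} (hw : IsCyclicallyReduced Γ w)
    (hw' : IsCyclicallyReduced Γ w') (h : eval Γ w * eval Γ g = eval Γ g * eval Γ w') :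
    ReflTransGen (Step Γ) w w' := by
  induction hn : g.length using Nat.strong_induction_on generalizing g w w' with
  | _ n ih =>
  subst hn
  by_cases hg : IsReduced Γ g
  swap
  · obtain ⟨g', hl, e⟩ := exists_shorter_of_not_isReduced hg
    exact ih _ hl g' hw hw' (by rw [e, h]) rfl
  by_cases hwg : IsReduced Γ (w ++ g)
  swap
  · obtain ⟨l, u, g', h1, h2⟩ := exists_cancel_of_not_isReduced_append hw.1 hg hwg
    have hs : ReflTransGen (Step Γ) w (l :: u) := h1.steps.trans (steps_append_comm u [l])
    refine hs.trans (ih g'.length ?_ g' (hw.of_steps hs) hw' ?_ rfl)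
    · simp [h2.length_eq]
    · rw [h1.eval_eq, h2.eval_eq, eval_cons (inv l), eval_append, eval_inv] at h
      rw [eval_cons]
      apply mul_left_cancel (a := (eval Γ [l])⁻¹)
      simpa [mul_assoc] using h
  by_cases hgw : IsReduced Γ (g ++ w')
  swap
  · obtain ⟨l, g', u, h1, h2⟩ := exists_cancel_of_not_isReduced_append hg hw'.1 hgw
    have hs : ReflTransGen (Step Γ) w' (u ++ [inv l]) :=
      h2.steps.trans (steps_append_comm [inv l] u)
    have hs' : ReflTransGen (Step Γ) (u ++ [inv l]) w' :=
      (steps_append_comm u [inv l]).trans h2.symm.steps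
    refine (ih g'.length ?_ g' hw (hw'.of_steps hs) ?_ rfl).trans hs'
    · simp [h1.length_eq]
    · rw [h1.eval_eq, h2.eval_eq, eval_cons (inv l), eval_append, eval_inv] at h
      rw [eval_append, eval_inv]
      apply mul_right_cancel (b := eval Γ [l])
      simpa [mul_assoc] using h
  have he : CommEquiv Γ (w ++ g) (g ++ w') :=
    commEquiv_of_eval_eq hwg hgw (by rw [eval_append, eval_append, h])
  cases g with
  | nil => simpa using he.steps
  | cons l g =>
    have hi : IsInitial Γ l (w ++ l :: g) :=
      (IsInitial.congr he l).2 (Or.inl rfl)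
    rcases isInitial_append hi with hi | ⟨hc, -⟩
    · have h1 := hi.commEquiv
      have hs := h1.steps.trans (steps_append_comm [l] (w.erase l))
      refine hs.trans (ih g.length (by simp) g (hw.of_steps hs) hw' ?_ rfl)
      rw [h1.eval_eq, eval_cons, eval_cons l g] at h
      rw [eval_append]
      apply mul_left_cancel (a := eval Γ [l])
      simpa [mul_assoc] using h
    · refine ih g.length (by simp) g hw hw' ?_ rfl
      have h1 : eval Γ [l] * eval Γ w = eval Γ w * eval Γ [l] := by
        rw [← eval_append, ← eval_append]
        simpa using (CommEquiv.move l w [] hc).eval_eq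
      rw [eval_cons, ← mul_assoc, ← h1] at h
      apply mul_left_cancel (a := eval Γ [l])
      simpa [mul_assoc] using h

/-- Conjugate cyclically reduced words are related by cyclings and commutations. -/
theorem IsCyclicallyReduced.steps_of_isConj {w w' : Word N} (hw : IsCyclicallyReduced Γ w)
    (hw' : IsCyclicallyReduced Γ w') (h : IsConj (eval Γ w) (eval Γ w')) :
    ReflTransGen (Step Γ) w w' := by
  obtain ⟨c, hc⟩ := isConj_iff.1 h
  -- `c w c⁻¹ = w'` is the same as `w c⁻¹ = c⁻¹ w'`, so the conjugating word represents `c⁻¹`.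
  obtain ⟨x, hx⟩ := PresentedGroup.mk_surjective (relators Γ) c⁻¹
  have hx' : eval Γ x.toWord = c⁻¹ := by rw [eval, FreeGroup.mk_toWord, hx]
  refine steps_of_eval_mul_eq x.toWord hw hw' ?_
  rw [hx', ← hc]
  group

/-! ### Bi-infinite words -/

/-- The bi-infinite words `f` and `f'` are related by a bijection of positions preserving letters
and the order of any two positions whose letters have equal or adjacent indices. -/
def HeapEquiv (Γ : SimpleGraph (Fin N)) (f f' : ℤ → Letter N) : Prop :=
  ∃ σ : ℤ ≃ ℤ, (∀ i, f' i = f (σ i)) ∧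
    ∀ i j, (f' i).1 = (f' j).1 ∨ Γ.Adj (f' i).1 (f' j).1 → i < j → σ i < σ j

theorem HeapEquiv.refl (f : ℤ → Letter N) : HeapEquiv Γ f f :=
  ⟨Equiv.refl ℤ, fun _ => rfl, fun _ _ _ h => h⟩

theorem HeapEquiv.trans {f g h : ℤ → Letter N} (h₁ : HeapEquiv Γ f g) (h₂ : HeapEquiv Γ g h) :
    HeapEquiv Γ f h := by
  obtain ⟨σ, hσ, hσ'⟩ := h₁
  obtain ⟨τ, hτ, hτ'⟩ := h₂
  refine ⟨τ.trans σ, fun i => by rw [hτ, hσ]; rfl, fun i j hd hij => ?_⟩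
  exact hσ' _ _ (by rwa [← hτ, ← hτ]) (hτ' i j hd hij)

/-- Normality of a bi-infinite word: a letter is never preceded by a word of letters commuting
with it that begins with a letter of smaller index. -/
def IsBiNormal (Γ : SimpleGraph (Fin N)) (f : ℤ → Letter N) : Prop :=
  ∀ i j, i < j → (f i).1 < (f j).1 → ∃ m, i ≤ m ∧ m < j ∧ Γ.Adj (f m).1 (f j).1

/-- Normality puts an adjacent letter between `i` and `j`. If its index still exceeds that of `i`,
repeat with it in place of `j`; the gap shrinks, and `τ` increases along the resulting chain of
adjacent letters. -/
theorem IsBiNormal.exists_lt {f : ℤ → Letter N} (hf : IsBiNormal Γ f) {τ : ℤ → ℤ}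
    (hτ : ∀ i j, Γ.Adj (f i).1 (f j).1 → i < j → τ i < τ j) {i j : ℤ} (hij : i < j)
    (hlt : (f i).1 < (f j).1) :
    ∃ m, i ≤ m ∧ m < j ∧ (f m).1 ≤ (f i).1 ∧ τ m < τ j := by
  induction hn : (j - i).toNat using Nat.strong_induction_on generalizing j with
  | _ n ih =>
  obtain ⟨m, him, hmj, ha⟩ := hf i j hij hlt
  have hm := hτ m j ha hmj
  by_cases hle : (f m).1 ≤ (f i).1
  · exact ⟨m, him, hmj, hle, hm⟩
  · have him' : i < m := lt_of_le_of_ne him (by rintro rfl; exact hle le_rfl)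
    obtain ⟨m', h1, h2, h3, h4⟩ := ih (m - i).toNat (by omega) him' (not_le.1 hle) rfl
    exact ⟨m', h1, h2.trans hmj, h3, h4.trans hm⟩

/-- Induction on a bound for the two indices. An inverted pair has distinct indices.
`IsBiNormal.exists_lt`, applied on the side where the smaller index comes first (`f'` with `σ`, or
`f` with `σ.symm`), replaces the letter of larger index by one whose index is at most the smaller,
and the pair stays inverted. This contradicts the induction hypothesis. -/
theorem strictMono_of_isBiNormal {f f' : ℤ → Letter N} (hf : IsBiNormal Γ f)
    (hf' : IsBiNormal Γ f') {σ : ℤ ≃ ℤ} (hσ : ∀ i, f' i = f (σ i))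
    (hd : ∀ i j, (f' i).1 = (f' j).1 ∨ Γ.Adj (f' i).1 (f' j).1 → i < j → σ i < σ j) :
    StrictMono σ := by
  -- The order is total, so preserving it on adjacent pairs also reflects it.
  have hd' : ∀ i j, Γ.Adj (f i).1 (f j).1 → i < j → σ.symm i < σ.symm j := by
    intro i j ha hij
    by_contra hlt
    have hne : σ.symm j ≠ σ.symm i := fun e => hij.ne' (σ.symm.injective e)
    have := hd (σ.symm j) (σ.symm i) (.inr (by simpa [hσ] using ha.symm))
      (lt_of_le_of_ne (not_lt.1 hlt) hne)
    simp only [Equiv.apply_symm_apply] at this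
    exact absurd this hij.not_gt
  have key : ∀ k : ℕ, ∀ i j, ((f' i).1 : ℕ) < k → ((f' j).1 : ℕ) < k → i < j → σ i < σ j := by
    intro k
    induction k with
    | zero => intro i j h; omega
    | succ k ih =>
      intro i j hi hj hij
      by_contra hlt
      have hji : σ j < σ i := lt_of_le_of_ne (not_lt.1 hlt) fun e => hij.ne' (σ.injective e)
      rcases lt_trichotomy (f' i).1 (f' j).1 with h | h | h
      · obtain ⟨m, h1, h2, h3, h4⟩ :=
          hf'.exists_lt (τ := σ) (fun i j ha => hd i j (.inr ha)) hij h
        have him : i < m := lt_of_le_of_ne h1 (by rintro rfl; exact absurd h4 hlt)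
        have h5 : ((f' i).1 : ℕ) < (f' j).1 := h
        have h6 : ((f' m).1 : ℕ) ≤ (f' i).1 := h3
        have := ih i m (by omega) (by omega) him
        omega
      · exact hlt (hd i j (.inl h) hij)
      · rw [hσ, hσ] at h
        obtain ⟨m, h1, h2, h3, h4⟩ := hf.exists_lt hd' hji h
        rw [Equiv.symm_apply_apply] at h4
        have h5 : ((f (σ j)).1 : ℕ) < (f (σ i)).1 := h
        have h6 : ((f m).1 : ℕ) ≤ (f (σ j)).1 := h3
        rw [hσ] at hi hj
        have := ih (σ.symm m) j (by rw [hσ, Equiv.apply_symm_apply]; omega)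
          (by rw [hσ]; omega) (h4.trans hij)
        rw [Equiv.apply_symm_apply] at this
        omega
  exact fun i j hij => key N i j (f' i).1.isLt (f' j).1.isLt hij

/-- If `σ` skipped the value `σ i + 1` at `i + 1`, its preimage would lie strictly between `i` and
`i + 1`. -/
theorem exists_eq_add_of_strictMono {σ : ℤ ≃ ℤ} (h : StrictMono σ) : ∃ c, ∀ i, σ i = i + c := by
  have hs (i : ℤ) : σ (i + 1) = σ i + 1 := by
    have h1 : σ i < σ (i + 1) := h (by omega)
    by_contra hne
    have h2 : σ i < σ (σ.symm (σ i + 1)) := by simp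
    have h3 : σ (σ.symm (σ i + 1)) < σ (i + 1) := by rw [Equiv.apply_symm_apply]; omega
    have := h.lt_iff_lt.1 h2
    have := h.lt_iff_lt.1 h3
    omega
  refine ⟨σ 0, fun i => ?_⟩
  induction i using Int.induction_on with
  | zero => simp
  | succ n ih => rw [hs, ih]; ring
  | pred n ih =>
    have := hs (-(n : ℤ) - 1)
    rw [sub_add_cancel, ih] at this
    omega

/-- Bi-infinite normal words with equivalent heaps are translates of each other. -/
theorem HeapEquiv.exists_shift {f f' : ℤ → Letter N} (h : HeapEquiv Γ f f')
    (hf : IsBiNormal Γ f) (hf' : IsBiNormal Γ f') : ∃ c, ∀ i, f' i = f (i + c) := by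
  obtain ⟨σ, hσ, hd⟩ := h
  obtain ⟨c, hc⟩ := exists_eq_add_of_strictMono (strictMono_of_isBiNormal hf hf' hσ hd)
  exact ⟨c, fun i => by rw [hσ, hc]⟩

/-! ### Periodic words -/

/-- The periodic bi-infinite word with period `w`; the letter `d` is only used if `w` is empty. -/
def periodic (d : Letter N) (w : Word N) (i : ℤ) : Letter N :=
  w.getD (i % w.length).toNat d

theorem periodic_of_emod_eq (d : Letter N) {w : Word N} {i : ℤ} {k : ℕ} (hk : k < w.length)
    (h : i % w.length = k) : periodic d w i = w[k] := by
  rw [periodic, h, Int.toNat_natCast, List.getD_eq_getElem _ _ hk]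

theorem exists_emod_eq {n : ℕ} (hn : 0 < n) (i : ℤ) : ∃ k : ℕ, k < n ∧ i % n = k := by
  have h0 : (0 : ℤ) < n := by exact_mod_cast hn
  have h1 := Int.emod_nonneg i h0.ne'
  have h2 := Int.emod_lt_of_pos i h0
  exact ⟨(i % n).toNat, by omega, by omega⟩

theorem add_emod_eq {n i r c : ℤ} (h : i % n = r) (h0 : 0 ≤ r + c) (h1 : r + c < n) :
    (i + c) % n = r + c := by
  rw [Int.add_emod, h, Int.add_emod_emod, Int.emod_eq_of_lt h0 h1]

theorem periodic_cycling (d l : Letter N) (t : Word N) (i : ℤ) :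
    periodic d (t ++ [l]) i = periodic d (l :: t) (i + 1) := by
  have hl : (t ++ [l]).length = (l :: t).length := by simp
  obtain ⟨k, hk, hi⟩ := exists_emod_eq (n := (l :: t).length) (by simp) i
  rw [periodic_of_emod_eq d (k := k) (by rwa [hl]) (by rwa [hl])]
  simp only [List.length_cons] at hk
  by_cases hkt : k < t.length
  · rw [periodic_of_emod_eq d (k := k + 1) (by simpa using hkt)]
    · simp [List.getElem_append_left hkt]
    · exact add_emod_eq hi (by omega) (by simp only [List.length_cons]; omega)
  · have hkt' : k = t.length := by omega
    subst hkt'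
    rw [periodic_of_emod_eq d (k := 0) (by simp)]
    · simp
    · rw [Int.add_emod, hi]; simp

theorem Step.length_eq {w w' : Word N} (h : Step Γ w w') : w.length = w'.length := by
  cases h <;> simp

theorem getElem?_swap_of_ne {α : Type*} (u v : List α) (l l' : α) {k : ℕ} (h : k ≠ u.length)
    (h' : k ≠ u.length + 1) : (u ++ l' :: l :: v)[k]? = (u ++ l :: l' :: v)[k]? := by
  rcases lt_or_ge k u.length with hk | hk
  · rw [List.getElem?_append_left hk, List.getElem?_append_left hk]
  · obtain ⟨q, rfl⟩ : ∃ q, k = u.length + (q + 2) := ⟨k - u.length - 2, by omega⟩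
    simp [List.getElem?_append_right]

/-- The bijection exchanges the two positions in every period at once. Only pairs of exchanged
neighbours are inverted, and their indices are neither equal nor adjacent. -/
theorem heapEquiv_commutation (d : Letter N) (u v : Word N) {l l' : Letter N}
    (ha : ¬ Γ.Adj l.1 l'.1) (hne : l.1 ≠ l'.1) :
    HeapEquiv Γ (periodic d (u ++ l :: l' :: v)) (periodic d (u ++ l' :: l :: v)) := by
  obtain ⟨n, hn⟩ : ∃ n, n = (u ++ l :: l' :: v).length := ⟨_, rfl⟩
  have hn' : n = (u ++ l' :: l :: v).length := by simp [hn]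
  obtain ⟨k, hk⟩ : ∃ k, k = u.length := ⟨_, rfl⟩
  have hkn : k + 1 < n := by simp [hn, hk]
  have up {i : ℤ} (h : i % n = k) : (i + 1) % n = k + 1 := add_emod_eq h (by omega) (by omega)
  have down {i : ℤ} (h : i % n = k + 1) : (i - 1) % n = k := by
    have := add_emod_eq (c := -1) h (by omega) (by omega)
    simpa [sub_eq_add_neg] using this
  let s : ℤ → ℤ := fun i => if i % n = k then i + 1 else if i % n = k + 1 then i - 1 else i
  have s_def (i : ℤ) : s i = if i % n = k then i + 1 else if i % n = k + 1 then i - 1 else i :=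
    rfl
  have hs : Function.Involutive s := by
    intro i
    by_cases h1 : i % n = k
    · have e : s i = i + 1 := by rw [s_def, if_pos h1]
      rw [e, s_def, if_neg (by rw [up h1]; omega), if_pos (up h1)]
      ring
    · by_cases h2 : i % n = k + 1
      · have e : s i = i - 1 := by rw [s_def, if_neg h1, if_pos h2]
        rw [e, s_def, if_pos (down h2)]
        ring
      · have e : s i = i := by rw [s_def, if_neg h1, if_neg h2]
        rw [e, e]
  have val0 {i : ℤ} (h : i % n = k) : periodic d (u ++ l' :: l :: v) i = l' := by
    rw [periodic_of_emod_eq d (k := k) (by omega) (by rw [← hn', h])]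
    simp [hk]
  have val1 {i : ℤ} (h : i % n = k + 1) : periodic d (u ++ l' :: l :: v) i = l := by
    rw [periodic_of_emod_eq d (k := k + 1) (by omega) (by rw [← hn', h]; simp)]
    simp [hk]
  refine ⟨hs.toPerm, fun i => ?_, fun i j hdep hij => ?_⟩
  · change _ = periodic d _ (s i)
    by_cases h1 : i % n = k
    · rw [val0 h1, s_def, if_pos h1,
        periodic_of_emod_eq d (k := k + 1) (by omega) (by rw [← hn, up h1]; simp)]
      simp [hk]
    · by_cases h2 : i % n = k + 1
      · rw [val1 h2, s_def, if_neg h1, if_pos h2,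
          periodic_of_emod_eq d (k := k) (by omega) (by rw [← hn, down h2])]
        simp [hk]
      · rw [s_def, if_neg h1, if_neg h2, periodic, periodic, ← hn, ← hn', List.getD, List.getD]
        rw [getElem?_swap_of_ne]
        · have := Int.emod_nonneg i (b := n) (by omega)
          omega
        · omega
  · change s i < s j
    by_contra hlt
    have hji : s j < s i := lt_of_le_of_ne (not_lt.1 hlt) fun e => hij.ne' (hs.injective e)
    -- Each position moves by at most one, so an inverted pair must be one of the exchanged pairs.
    have h : i % n = k ∧ j = i + 1 := by
      rw [s_def, s_def] at hji
      split_ifs at hji <;> first | (exfalso; omega) | exact ⟨by assumption, by omega⟩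
    obtain ⟨h, rfl⟩ := h
    rw [val0 h, val1 (up h)] at hdep
    rcases hdep with h | h
    · exact hne h.symm
    · exact ha h.symm

theorem Step.heapEquiv (d : Letter N) {w w' : Word N} (h : Step Γ w w') (hw : IsReduced Γ w) :
    HeapEquiv Γ (periodic d w) (periodic d w') := by
  cases h with
  | cycling l t =>
    exact ⟨Equiv.addRight 1, periodic_cycling d l t, fun i j _ hij => by simpa using hij⟩
  | commutation u v l l' ha =>
    by_cases hne : l.1 = l'.1
    -- Exchanging equal letters changes nothing, and neighbouring inverse letters contradict
    -- reducedness.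
    · rcases eq_or_eq_inv_of_fst_eq hne with rfl | rfl
      · exact .refl _
      · exact (hw ⟨u, [], v, l'.1, !l'.2, by simp [inv], by simp⟩).elim
    · exact heapEquiv_commutation d u v ha hne

theorem IsCyclicallyReduced.heapEquiv (d : Letter N) {w w' : Word N}
    (hw : IsCyclicallyReduced Γ w) (h : Relation.ReflTransGen (Step Γ) w w') :
    w.length = w'.length ∧ HeapEquiv Γ (periodic d w) (periodic d w') := by
  induction h with
  | refl => exact ⟨rfl, .refl _⟩
  | tail h₁ h₂ ih =>
    exact ⟨ih.1.trans h₂.length_eq, ih.2.trans (h₂.heapEquiv d (hw.2 _ h₁))⟩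

/-- Otherwise `w[k]` could be moved to the front, giving a reduced word for the same element with a
larger first index. -/
theorem IsInitiallyNormal.exists_adj {w : Word N} (h : IsInitiallyNormal Γ w) {k : ℕ}
    (hk : k < w.length) (hlt : (w[0]).1 < (w[k]).1) :
    ∃ m, ∃ hm : m < k, Γ.Adj (w[m]).1 (w[k]).1 := by
  by_contra! hc
  have hx : ∀ b ∈ w.take k, ¬ Γ.Adj (w[k]).1 b.1 := by
    intro b hb hadj
    obtain ⟨m, hm, rfl⟩ := List.mem_take_iff_getElem.1 hb
    exact hc m (by omega) hadj.symm
  have he := CommEquiv.move w[k] (w.take k) (w.drop (k + 1)) hx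
  have hw : w.take k ++ w[k] :: w.drop (k + 1) = w := by simp
  rw [hw] at he
  have h0 : w = w[0] :: w.tail := by
    cases w with
    | nil => simp at hk
    | cons l t => rfl
  exact absurd (h.2 _ _ h0 _ _ ((IsReduced.congr he).2 h.1) he.eval_eq) hlt.not_ge

theorem getElem_rotate_eq_periodic (d : Letter N) {w : Word N} {k r : ℕ} {i : ℤ}
    (hi : i % w.length = r) (hk : k < (w.rotate r).length) :
    (w.rotate r)[k] = periodic d w (i + k) := by
  have hk' : k < w.length := by simpa using hk
  have hp : 0 < w.length := by omega
  rw [List.getElem_rotate, periodic_of_emod_eq d (k := (k + r) % w.length) (Nat.mod_lt _ hp)]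
  rw [← Int.emod_add_emod, hi, add_comm]
  push_cast
  rfl

theorem IsCyclicNormalForm.isBiNormal (d : Letter N) {w : Word N} (h : IsCyclicNormalForm Γ w)
    (hne : w ≠ []) : IsBiNormal Γ (periodic d w) := by
  intro i j hij hlt
  have hpos : 0 < w.length := List.length_pos_iff.2 hne
  obtain ⟨r, hr, hi⟩ := exists_emod_eq hpos i
  obtain ⟨k, hk, hj⟩ := exists_emod_eq hpos (j - i)
  -- The position `i + k` carries the same letter as `j` and lies within one period of `i`, so
  -- normality of the rotation starting at `i` applies. A blocking letter before `i + k` is also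
  -- before `j`.
  have hkj : (i + k : ℤ) ≤ j := by
    have : (j - i) % w.length ≤ j - i := by
      have h1 := Int.mul_ediv_add_emod (j - i) w.length
      have h2 : 0 ≤ (w.length : ℤ) * ((j - i) / w.length) := by
        have := Int.ediv_nonneg (a := j - i) (b := w.length) (by omega) (by omega)
        positivity
      omega
    omega
  have hpj : periodic d w (i + k) = periodic d w j := by
    rw [periodic, periodic, ← hj, Int.add_emod_emod, add_sub_cancel]
  have hnorm : IsNormal Γ (w.rotate r) := h.2.2 _ ⟨r, rfl⟩
  have hk' : k < (w.rotate r).length := by simpa using hk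
  obtain ⟨m, hm, ha⟩ := (hnorm.2 _ List.suffix_rfl).exists_adj hk' (by
    rw [getElem_rotate_eq_periodic d hi, getElem_rotate_eq_periodic d hi, hpj]
    simpa using hlt)
  rw [getElem_rotate_eq_periodic d hi, getElem_rotate_eq_periodic d hi, hpj] at ha
  exact ⟨i + m, by omega, by omega, ha⟩

theorem isRotated_of_periodic_eq (d : Letter N) {w w' : Word N} (hl : w.length = w'.length)
    (hne : w ≠ []) {c : ℤ} (h : ∀ i, periodic d w' i = periodic d w (i + c)) : w ~r w' := by
  obtain ⟨r, hr, hc⟩ := exists_emod_eq (List.length_pos_iff.2 hne) c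
  refine ⟨r, List.ext_getElem (by simpa using hl) fun k h1 h2 => ?_⟩
  rw [getElem_rotate_eq_periodic d hc, add_comm, ← h,
    periodic_of_emod_eq d h2 (Int.emod_eq_of_lt (by omega) (by omega))]

theorem IsCyclicNormalForm.isRotated_of_steps {w w' : Word N} (hw : IsCyclicNormalForm Γ w)
    (hw' : IsCyclicNormalForm Γ w') (h : Relation.ReflTransGen (Step Γ) w w') : w ~r w' := by
  cases hc : w with
  | nil =>
    rw [hc] at h
    cases h.cases_head with
    | inl h => rw [← h]
    | inr h =>
      obtain ⟨v, hv, -⟩ := h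
      -- No cycling or commutation starts from the empty word.
      generalize hz : ([] : Word N) = z at hv
      cases hv <;> simp at hz
  | cons d t =>
    rw [← hc]
    have hne : w ≠ [] := by simp [hc]
    obtain ⟨hl, he⟩ := hw.1.heapEquiv d h
    have hne' : w' ≠ [] := by
      rw [← List.length_pos_iff, ← hl]
      exact List.length_pos_iff.2 hne
    obtain ⟨c, hc⟩ := he.exists_shift (hw.isBiNormal d hne) (hw'.isBiNormal d hne')
    exact isRotated_of_periodic_eq d hl hne hc

theorem steps_of_isRotated {w w' : Word N} (h : w ~r w') :
    Relation.ReflTransGen (Step Γ) w w' := by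
  obtain ⟨r, hr, rfl⟩ := List.isRotated_iff_mod.1 h
  rw [List.rotate_eq_drop_append_take hr]
  simpa using steps_append_comm (Γ := Γ) (w.take r) (w.drop r)

end RAAG

theorem propositionT {N : ℕ} (Γ : SimpleGraph (Fin N)) (w w' : RAAG.Word N)
    (hw : RAAG.IsCyclicNormalForm Γ w) (hw' : RAAG.IsCyclicNormalForm Γ w') :
    IsConj (RAAG.eval Γ w) (RAAG.eval Γ w') ↔ w ~r w' :=
  ⟨fun h => hw.isRotated_of_steps hw' (hw.1.steps_of_isConj hw'.1 h),
    fun h => RAAG.steps_isConj (RAAG.steps_of_isRotated h)⟩
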